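/- **Setting.** Let $\mathcal S,\mathcal A$ be finite sets, $r:\mathcal S\times\mathcal A\to\mathbb R$ a reward function, $p(s'\mid s,a)$ a transition kernel, and $\pi(a\mid s)$ a policy such that the Markov chain on $\mathcal S$ induced by $\pi$ is a unichain (it has exactly one recurrent class). Let $d_\mu$ be a probability distribution on $\mathcal S\times\mathcal A$ with $d_\mu(s,a)>0$ for all $(s,a)$, and let $(S_k,A_k,R_k,S_k',A_k')$, $k\ge 0$, be i.i.d. with $(S_k,A_k)\sim d_\mu$, $R_k=r(S_k,A_k)$, $S_k'\sim p(\cdot\mid S_k,A_k)$ and $A_k'\sim\pi(\cdot\mid S_k')$. Let $x(s,a)\in\mathbb R^K$ be feature vectors and $X\in\mathbb R^{|\mathcal S||\mathcal A|\times K}$ the matrix with rows $x(s,a)^\top$; assume $Xw\ne c\mathbf 1$ for all $w\in\mathbb R^K\setminus\{0\}$ and $c\in\mathbb R$. Let $(\alpha_k)$ be a positive, deterministic, nonincreasing sequence with $\sum_k\alpha_k=\infty$ and $\sum_k\alpha_k^2<\infty$. Write $y_k=[1,x(S_k,A_k)^\top]^\top$, $y_k'=[1,x(S_k',A_k')^\top]^\top$,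 $e_1=[1,0,\dots,0]^\top\in\mathbb R^{K+1}$, $I_0=\mathrm{diag}(\mathbf 1-e_1)$, $Y=[\mathbf 1,X]$, $D=\mathrm{diag}(d_\mu)$, $P_\pi((s,a),(s',a'))=p(s'\mid s,a)\pi(a'\mid s')$, $\|v\|_M^2=v^\top Mv$, and $$A=\mathbb E[y_k(-e_1+y_k'-y_k)^\top],\qquad b=\mathbb E[y_kR_k],\qquad C=Y^\top DY.$$ For $u=[\hat r,w^\top]^\top\in\mathbb R^{K+1}$ let $\bar\delta(u)=r-(e_1^\top u)\mathbf 1+P_\pi Yu-Yu$, $\Pi_Y=Y(Y^\top DY)^{-1}Y^\top D$, $\mathrm{MSPBE}_1(u)=\|\Pi_Y\bar\delta(u)\|_D^2$ and $$J_{1,\eta}(u)=\|Au+b\|_{C^{-1}}^2+\eta\,u^\top I_0u .$$ For $\eta\ge 0$ and arbitrary initial vectors $\nu_0,u_0\in\mathbb R^{K+1}$ (possibly random), Diff-GQ1 generates $$\delta_k=R_k-e_1^\top u_k+y_k'^\top u_k-y_k^\top u_k,\qquad \nu_{k+1}=\nu_k+\alpha_k(\delta_k-y_k^\top\nu_k)y_k,$$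 $$u_{k+1}=u_k+\alpha_k(y_k-y_k'+e_1)y_k^\top\nu_k-\alpha_k\eta I_0u_k .$$ **Theorem 1.** The matrix $C$ is invertible, and $J_{1,\eta}(u)=\mathrm{MSPBE}_1(u)+\eta\|w\|^2$ for all $\eta\in\mathbb R$ and all $u=[\hat r,w^\top]^\top$. For every $\eta>0$ the matrix $\eta I_0+A^\top C^{-1}A$ is invertible, $u_k$ converges almost surely to $$u_\eta^*=-(\eta I_0+A^\top C^{-1}A)^{-1}A^\top C^{-1}b,$$ and $u_\eta^*$ is the unique minimizer of $J_{1,\eta}$ over $\mathbb R^{K+1}$. If $A$ is invertible, then the same holds for $\eta=0$, and the limit is $u_0^*=u_{\mathrm{TD}}=-A^{-1}b$, the unique TD fixed point, i.e. the unique $u$ with $\mathbb E[(R_k-e_1^\top u+y_k'^\top u-y_k^\top u)\,y_k]=\mathbf 0$. -/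

import Mathlib

open MeasureTheory ProbabilityTheory Filter Topology Matrix

namespace DiffGQ

/-- A finite Markov decision process: a reward function and a transition kernel,
where `trans s a s'` is the probability `p(s' | s, a)`. -/
structure MDP (S A : Type*) [Fintype S] where
  reward : S → A → ℝ
  trans : S → A → S → ℝ
  trans_nonneg : ∀ s a s', 0 ≤ trans s a s'
  trans_sum : ∀ s a, ∑ s', trans s a s' = 1

/-- A stationary randomized policy; `prob s a` is the probability `π(a | s)`. -/
structure Policy (S A : Type*) [Fintype A] where
  prob : S → A → ℝ
  prob_nonneg : ∀ s a, 0 ≤ prob s a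
  prob_sum : ∀ s, ∑ a, prob s a = 1

/-- A recurrent class of a finite Markov chain with transition matrix `P`: a nonempty set of
states that the chain cannot leave and any two members of which can reach each other. -/
def IsRecurrentClass {S : Type*} (P : Matrix S S ℝ) (R : Set S) : Prop :=
  R.Nonempty ∧ (∀ s ∈ R, ∀ t, 0 < P s t → t ∈ R) ∧
    ∀ s ∈ R, ∀ t ∈ R, Relation.ReflTransGen (fun i j => 0 < P i j) s t

/-- A finite chain is a unichain if it has exactly one recurrent class; the remaining states, if
any, are transient. -/
def IsUnichain {S : Type*} (P : Matrix S S ℝ) : Prop :=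
  ∃! R : Set S, IsRecurrentClass P R

/-- Standard stepsizes: positive, nonincreasing, not summable, square summable. -/
structure IsStepsize (α : ℕ → ℝ) : Prop where
  pos : ∀ k, 0 < α k
  antitone : Antitone α
  sum_eq_top : Tendsto (fun n => ∑ k ∈ Finset.range n, α k) atTop atTop
  sq_summable : Summable fun k => α k ^ 2

/-- `‖v‖²_M = vᵀ M v`. -/
def sqNorm {n : Type*} [Fintype n] (M : Matrix n n ℝ) (v : n → ℝ) : ℝ :=
  v ⬝ᵥ (M *ᵥ v)

/-- The first standard basis vector `e₁` of `ℝ^(K+1)`. -/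
def e1 (K : ℕ) : Fin (K + 1) → ℝ := Pi.single 0 1

/-- `I₀ = diag(1 - e₁)`. -/
def I0 (K : ℕ) : Matrix (Fin (K + 1)) (Fin (K + 1)) ℝ := Matrix.diagonal (1 - e1 K)

section

variable {S A : Type*} {K : ℕ}

/-- The augmented feature vector `y(s, a) = [1, x(s, a)ᵀ]ᵀ`. -/
def y (x : S × A → Fin K → ℝ) (i : S × A) : Fin (K + 1) → ℝ := Fin.cons 1 (x i)

/-- The feature matrix `X`, whose row `(s, a)` is `x(s, a)ᵀ`. -/
def X (x : S × A → Fin K → ℝ) : Matrix (S × A) (Fin K) ℝ := Matrix.of x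

/-- The augmented feature matrix `Y = [1, X]`, whose row `(s, a)` is `y(s, a)ᵀ`. -/
def Y (x : S × A → Fin K → ℝ) : Matrix (S × A) (Fin (K + 1)) ℝ := Matrix.of (y x)

variable [Fintype S] [Fintype A]

/-- The transition matrix on states of the chain that `π` induces. -/
def stateMatrix (M : MDP S A) (π : Policy S A) : Matrix S S ℝ :=
  Matrix.of fun s s' => ∑ a, π.prob s a * M.trans s a s'

/-- The transition matrix `P_π` on state-action pairs, `p(s' | s, a) π(a' | s')`. -/
def Pmat (M : MDP S A) (π : Policy S A) : Matrix (S × A) (S × A) ℝ :=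
  Matrix.of fun i j => M.trans i.1 i.2 j.1 * π.prob j.1 j.2

/-- The reward function as a vector. -/
def rvec (M : MDP S A) : S × A → ℝ := fun i => M.reward i.1 i.2

/-- The probability that the sampling distribution gives to `((s, a), (s', a'))`:
`(s, a)` has the law `d`, then `s' ∼ p(· | s, a)` and `a' ∼ π(· | s')`. -/
def sampleMass (M : MDP S A) (π : Policy S A) (d : S × A → ℝ) (z : (S × A) × (S × A)) : ℝ :=
  d z.1 * (M.trans z.1.1 z.1.2 z.2.1 * π.prob z.2.1 z.2.2)

/-- Expectation of a function of `((s, a), (s', a'))` under the sampling distribution. -/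
def expect (M : MDP S A) (π : Policy S A) (d : S × A → ℝ) {V : Type*} [AddCommGroup V] [Module ℝ V]
    (f : (S × A) × (S × A) → V) : V :=
  ∑ z, sampleMass M π d z • f z

/-- The random variables `Z k = ((S_k, A_k), (S_k', A_k'))` are independent and each of them is
drawn from the sampling distribution. -/
structure IsIIDSample [MeasurableSpace S] [MeasurableSpace A] {Ω : Type*} [MeasurableSpace Ω]
    (M : MDP S A) (π : Policy S A) (d : S × A → ℝ) (μ : Measure Ω)
    (Z : ℕ → Ω → (S × A) × (S × A)) : Prop where
  measurable : ∀ k, Measurable (Z k)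
  indep : iIndepFun Z μ
  law : ∀ k z, μ (Z k ⁻¹' {z}) = ENNReal.ofReal (sampleMass M π d z)

/-- The temporal difference error `R - e₁ᵀu + y'ᵀu - yᵀu` of the sample `z = ((s, a), (s', a'))`,
where `R = r(s, a)`. -/
def tdError (M : MDP S A) (x : S × A → Fin K → ℝ) (z : (S × A) × (S × A))
    (u : Fin (K + 1) → ℝ) : ℝ :=
  M.reward z.1.1 z.1.2 - e1 K ⬝ᵥ u + y x z.2 ⬝ᵥ u - y x z.1 ⬝ᵥ u

/-- A TD fixed point: a solution `u` of `𝔼[δ(u) y] = 0`. -/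
def IsTDFixedPoint (M : MDP S A) (π : Policy S A) (d : S × A → ℝ) (x : S × A → Fin K → ℝ)
    (u : Fin (K + 1) → ℝ) : Prop :=
  expect M π d (fun z => tdError M x z u • y x z.1) = 0

/-- `A = 𝔼[y (-e₁ + y' - y)ᵀ]`. -/
def Amat (M : MDP S A) (π : Policy S A) (d : S × A → ℝ) (x : S × A → Fin K → ℝ) :
    Matrix (Fin (K + 1)) (Fin (K + 1)) ℝ :=
  expect M π d fun z => Matrix.vecMulVec (y x z.1) (-e1 K + y x z.2 - y x z.1)

/-- `b = 𝔼[y R]`. -/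
def bvec (M : MDP S A) (π : Policy S A) (d : S × A → ℝ) (x : S × A → Fin K → ℝ) :
    Fin (K + 1) → ℝ :=
  expect M π d fun z => M.reward z.1.1 z.1.2 • y x z.1

variable [DecidableEq S] [DecidableEq A]

/-- `C = Yᵀ D Y` with `D = diag(d)`. -/
def Cmat (d : S × A → ℝ) (x : S × A → Fin K → ℝ) : Matrix (Fin (K + 1)) (Fin (K + 1)) ℝ :=
  (Y x)ᵀ * Matrix.diagonal d * Y x

/-- The projection `Π_Y = Y (Yᵀ D Y)⁻¹ Yᵀ D`. -/
noncomputable def projY (d : S × A → ℝ) (x : S × A → Fin K → ℝ) : Matrix (S × A) (S × A) ℝ :=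
  Y x * ((Y x)ᵀ * Matrix.diagonal d * Y x)⁻¹ * (Y x)ᵀ * Matrix.diagonal d

/-- The vector of TD errors `δ̄(u) = r - (e₁ᵀu) 1 + P_π Y u - Y u`. -/
def tdErrorVec (M : MDP S A) (π : Policy S A) (x : S × A → Fin K → ℝ)
    (u : Fin (K + 1) → ℝ) : S × A → ℝ :=
  rvec M - (e1 K ⬝ᵥ u) • (1 : S × A → ℝ) + Pmat M π *ᵥ (Y x *ᵥ u) - Y x *ᵥ u

/-- `MSPBE₁(u) = ‖Π_Y δ̄(u)‖²_D`. -/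
noncomputable def mspbe1 (M : MDP S A) (π : Policy S A) (d : S × A → ℝ) (x : S × A → Fin K → ℝ)
    (u : Fin (K + 1) → ℝ) : ℝ :=
  sqNorm (Matrix.diagonal d) (projY d x *ᵥ tdErrorVec M π x u)

/-- The ridge-regularized objective `J_{1,η}(u) = ‖A u + b‖²_{C⁻¹} + η uᵀ I₀ u`. -/
noncomputable def J1 (M : MDP S A) (π : Policy S A) (d : S × A → ℝ) (x : S × A → Fin K → ℝ)
    (η : ℝ) (u : Fin (K + 1) → ℝ) : ℝ :=
  sqNorm (Cmat d x)⁻¹ (Amat M π d x *ᵥ u + bvec M π d x) + η * (u ⬝ᵥ (I0 K *ᵥ u))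

/-- The matrix `η I₀ + Aᵀ C⁻¹ A`. -/
noncomputable def Hmat (M : MDP S A) (π : Policy S A) (d : S × A → ℝ) (x : S × A → Fin K → ℝ)
    (η : ℝ) : Matrix (Fin (K + 1)) (Fin (K + 1)) ℝ :=
  η • I0 K + (Amat M π d x)ᵀ * (Cmat d x)⁻¹ * Amat M π d x

/-- `u*_η = -(η I₀ + Aᵀ C⁻¹ A)⁻¹ Aᵀ C⁻¹ b`. -/
noncomputable def uStar (M : MDP S A) (π : Policy S A) (d : S × A → ℝ) (x : S × A → Fin K → ℝ)
    (η : ℝ) : Fin (K + 1) → ℝ :=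
  -(((Hmat M π d x η)⁻¹ * (Amat M π d x)ᵀ * (Cmat d x)⁻¹) *ᵥ bvec M π d x)

/-- `u_TD = -A⁻¹ b`. -/
noncomputable def uTD (M : MDP S A) (π : Policy S A) (d : S × A → ℝ) (x : S × A → Fin K → ℝ) :
    Fin (K + 1) → ℝ :=
  -((Amat M π d x)⁻¹ *ᵥ bvec M π d x)

end

/-- The iterates `(ν_k, u_k)` of Diff-GQ1 along the sample path `z`, started at `κ₀ = (ν₀, u₀)`. -/
def diffGQ1 {S A : Type*} [Fintype S] [Fintype A] {K : ℕ} (M : MDP S A) (x : S × A → Fin K → ℝ) (η : ℝ)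
    (α : ℕ → ℝ) (z : ℕ → (S × A) × (S × A)) (κ₀ : (Fin (K + 1) → ℝ) × (Fin (K + 1) → ℝ)) :
    ℕ → (Fin (K + 1) → ℝ) × (Fin (K + 1) → ℝ)
  | 0 => κ₀
  | k + 1 =>
    let ν := (diffGQ1 M x η α z κ₀ k).1
    let u := (diffGQ1 M x η α z κ₀ k).2
    let yk := y x (z k).1
    let yk' := y x (z k).2
    let δ := tdError M x (z k) u
    (ν + (α k * (δ - yk ⬝ᵥ ν)) • yk,
      u + (α k * (yk ⬝ᵥ ν)) • (yk - yk' + e1 K) - (α k * η) • (I0 K *ᵥ u))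

end DiffGQ

/-!
The three algebraic facts about `C`, the objective and the TD fixed point follow from the moment
identity `Yᵀ D δ̄(u) = A u + b` (`Y_transpose_mul_diagonal_mulVec_tdErrorVec`) and from completing
the square around `u*` (`J1_eq_J1_uStar_add`). The matrix `η I₀ + Aᵀ C⁻¹ A` is positive definite as
soon as no direction is invisible both to the penalty and to `A` (`IsIdentified`). A positive
penalty ensures this, because it leaves only `e₁` unpenalized and the first component of `A e₁` is
`-1`; so does an invertible `A`.

For the convergence, the pair `(ν, u)` follows a linear stochastic approximation whose mean dynamics
is the saddle-point flow `ν' = A u + b - C ν`, `u' = -Aᵀ ν - η I₀ u`, stationary at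
`(C⁻¹ (A u* + b), u*)`. In deviations from that point the squared norm decreases only at the rate
`2 (ν ⬝ C ν + η u ⬝ I₀ u)`, which may vanish; subtracting `2 ε ν ⬝ A u` with a small `ε > 0` adds
the missing term `2 ε ‖A u‖²` and gives a strict quadratic Lyapunov function
(`exists_pos_crossForm_saddleField_neg`). Hence the Lyapunov function `V` of the noisy iteration
satisfies `𝔼[V_{k+1} | past] ≤ (1 - c αₖ) Vₖ + C αₖ² (1 + Vₖ)`, and the Robbins–Siegmund argument
(`ae_tendsto_zero_of_drift`) shows `V → 0` almost surely: a suitably discounted `1 + V`, plus the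
accumulated decrease, is a nonnegative supermartingale. As the noise takes finitely many values,
the iterates from a deterministic start are simple functions of it and all integrability is
automatic. Finally, the iterates are affine in the initial state, so convergence from the origin and
from a basis gives one null set that serves every initial state, however it depends on the noise
(`ae_forall_tendsto_linear`).
-/

namespace DiffGQ

/-! ### Functions of a finite noise sequence -/

/-- The states of a system driven by the noise sequence `z`, where `F k e t` is the state that
follows the state `e` if the noise at time `k` is `t`. -/
def chain {E T : Type*} (F : ℕ → E → T → E) (z : ℕ → T) (e₀ : E) : ℕ → E
  | 0 => e₀
  | k + 1 => F k (chain F z e₀ k) (z k)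

lemma finite_range_chain {Ω E T : Type*} [Finite T] (Z : ℕ → Ω → T) (F : ℕ → E → T → E) (e₀ : E)
    (k : ℕ) :
    (Set.range fun ω => chain F (fun j => Z j ω) e₀ k).Finite := by
  induction k with
  | zero => exact (Set.finite_singleton e₀).subset (by rintro _ ⟨ω, rfl⟩; rfl)
  | succ k ih =>
    refine (Set.Finite.image2 (F k) ih (Set.finite_univ (α := T))).subset ?_
    rintro _ ⟨ω, rfl⟩
    exact ⟨_, ⟨ω, rfl⟩, Z k ω, trivial, rfl⟩

section Chain

variable {Ω E T : Type*} [mΩ : MeasurableSpace Ω] [mT : MeasurableSpace T]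

/-- The filtration of the strict past: its `k`-th σ-algebra is generated by `Z 0, …, Z (k - 1)`. -/
def pastFiltration (Z : ℕ → Ω → T) (hZ : ∀ k, Measurable (Z k)) : Filtration ℕ mΩ where
  seq k := ⨆ j ∈ Set.Iio k, mT.comap (Z j)
  mono' _ _ hij := biSup_mono fun _ hk => lt_of_lt_of_le hk hij
  le' _ := iSup₂_le fun j _ => (hZ j).comap_le

variable {μ : Measure Ω} [IsProbabilityMeasure μ] [Fintype T] [MeasurableSingletonClass T]
  {Z : ℕ → Ω → T} (hZ : ∀ k, Measurable (Z k)) (F : ℕ → E → T → E) (e₀ : E)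

/-- The state at time `k` depends on the strict past only, so every event about it, measurable or
not as a subset of the state space, belongs to the σ-algebra of the past. -/
lemma measurableSet_chain (k : ℕ) (B : Set E) :
    MeasurableSet[pastFiltration Z hZ k] {ω | chain F (fun j => Z j ω) e₀ k ∈ B} := by
  induction k generalizing B with
  | zero =>
    by_cases h : e₀ ∈ B <;> simp [chain, h]
  | succ k ih =>
    have h : {ω | chain F (fun j => Z j ω) e₀ (k + 1) ∈ B} =
        ⋃ t : T, Z k ⁻¹' {t} ∩ {ω | chain F (fun j => Z j ω) e₀ k ∈ {e | F k e t ∈ B}} := by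
      ext ω
      simp [chain]
    rw [h]
    refine MeasurableSet.iUnion fun t => MeasurableSet.inter ?_ ?_
    · have hle : mT.comap (Z k) ≤ pastFiltration Z hZ (k + 1) :=
        le_biSup (fun j => mT.comap (Z j)) (Set.mem_Iio.2 k.lt_succ_self)
      exact hle _ ⟨{t}, measurableSet_singleton t, rfl⟩
    · exact (pastFiltration Z hZ).mono k.le_succ _ (ih _)

lemma stronglyMeasurable_comp_chain (k : ℕ) (φ : E → ℝ) :
    StronglyMeasurable[pastFiltration Z hZ k] fun ω => φ (chain F (fun j => Z j ω) e₀ k) :=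
  Measurable.stronglyMeasurable fun B _ => measurableSet_chain hZ F e₀ k (φ ⁻¹' B)

include hZ in
lemma integrable_comp_chain (k : ℕ) (φ : E → ℝ) :
    Integrable (fun ω => φ (chain F (fun j => Z j ω) e₀ k)) μ := by
  obtain ⟨C, hC⟩ := ((finite_range_chain Z F e₀ k).image fun e => ‖φ e‖).bddAbove
  refine Integrable.of_bound (C := C) ?_ (Eventually.of_forall fun ω => hC ⟨_, ⟨ω, rfl⟩, rfl⟩)
  exact ((stronglyMeasurable_comp_chain hZ F e₀ k φ).mono
    ((pastFiltration Z hZ).le k)).aestronglyMeasurable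

/-- The conditional expectation of a function of the next state averages over the noise. -/
lemma condExp_comp_chain_succ (hind : iIndepFun Z μ) {p : T → ℝ}
    (hp : ∀ k t, μ.real (Z k ⁻¹' {t}) = p t) (k : ℕ) (φ : E → ℝ) :
    μ[fun ω => φ (chain F (fun j => Z j ω) e₀ (k + 1)) | pastFiltration Z hZ k] =ᵐ[μ]
      fun ω => ∑ t, p t * φ (F k (chain F (fun j => Z j ω) e₀ k) t) := by
  classical
  set f : T → Ω → ℝ := fun t ω => φ (F k (chain F (fun j => Z j ω) e₀ k) t)
  set g : T → Ω → ℝ := fun t => (Z k ⁻¹' {t}).indicator fun _ => 1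
  have hg : ∀ t, Integrable (g t) μ := fun t =>
    (integrable_const _).indicator (hZ k (measurableSet_singleton t))
  have hfm : ∀ t, StronglyMeasurable[pastFiltration Z hZ k] (f t) := fun t =>
    stronglyMeasurable_comp_chain hZ F e₀ k fun e => φ (F k e t)
  have hfg : ∀ t, Integrable (f t * g t) μ := fun t => by
    have h : f t * g t = (Z k ⁻¹' {t}).indicator (f t) := by
      ext ω
      by_cases hω : ω ∈ Z k ⁻¹' {t} <;> simp [g, hω]
    rw [h]
    exact (integrable_comp_chain hZ F e₀ k fun e => φ (F k e t)).indicator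
      (hZ k (measurableSet_singleton t))
  have hdec : (fun ω => φ (chain F (fun j => Z j ω) e₀ (k + 1))) = ∑ t, f t * g t := by
    ext ω
    rw [Finset.sum_apply, Finset.sum_eq_single (Z k ω)]
    · simp [f, g, chain]
    · intro t _ ht
      simp [g, ht.symm]
    · simp
  have hindep : Indep (mT.comap (Z k)) (pastFiltration Z hZ k) μ := by
    have h := indep_iSup_of_disjoint (fun j => (hZ j).comap_le) hind.iIndep
      (S := {k}) (T := Set.Iio k) (by simp)
    rwa [iSup_singleton] at h
  have hterm : ∀ t, μ[f t * g t | pastFiltration Z hZ k] =ᵐ[μ] fun ω => p t * f t ω := fun t => by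
    have h1 := condExp_mul_of_stronglyMeasurable_left (hfm t) (hfg t) (hg t)
    have h2 : μ[g t | pastFiltration Z hZ k] =ᵐ[μ] fun _ => μ[g t] :=
      condExp_indep_eq (hZ k).comap_le ((pastFiltration Z hZ).le k)
        (stronglyMeasurable_one.indicator ⟨{t}, measurableSet_singleton t, rfl⟩) hindep
    filter_upwards [h1, h2] with ω e1 e2
    rw [e1, Pi.mul_apply, e2, integral_indicator_const _ (hZ k (measurableSet_singleton t)),
      hp k t, smul_eq_mul, mul_one, mul_comm]
  rw [hdec]
  refine (condExp_finsetSum (fun t _ => hfg t) _).trans ?_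
  filter_upwards [ae_all_iff.2 hterm] with ω hω
  rw [Finset.sum_apply]
  exact Finset.sum_congr rfl fun t _ => hω t

include hZ in
/-- A nonnegative function of time and state that does not grow on average converges along almost
every trajectory, because it is a nonnegative supermartingale. -/
lemma ae_exists_tendsto_of_average_le (hind : iIndepFun Z μ) {p : T → ℝ}
    (hp : ∀ k t, μ.real (Z k ⁻¹' {t}) = p t) {h : ℕ → E → ℝ} (hnonneg : ∀ k e, 0 ≤ h k e)
    (hle : ∀ k e, ∑ t, p t * h (k + 1) (F k e t) ≤ h k e) :
    ∀ᵐ ω ∂μ, ∃ l, Tendsto (fun k => h k (chain F (fun j => Z j ω) e₀ k)) atTop (𝓝 l) := by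
  set f : ℕ → Ω → ℝ := fun k ω => h k (chain F (fun j => Z j ω) e₀ k)
  have hf : Supermartingale f (pastFiltration Z hZ) μ := by
    refine supermartingale_nat (fun k => stronglyMeasurable_comp_chain hZ F e₀ k (h k))
      (fun k => integrable_comp_chain hZ F e₀ k (h k)) fun k => ?_
    filter_upwards [condExp_comp_chain_succ hZ F e₀ hind hp k (h (k + 1))] with ω hω
    exact hω.trans_le (hle k _)
  have hbdd : ∀ k, eLpNorm ((-f) k) 1 μ ≤ (Real.toNNReal (h 0 e₀) : ENNReal) := fun k => by
    have hk : ∫ ω, f k ω ∂μ ≤ h 0 e₀ := by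
      have := hf.setIntegral_le (Nat.zero_le k) MeasurableSet.univ
      simpa [f, chain] using this
    rw [Pi.neg_apply, eLpNorm_neg, eLpNorm_one_eq_lintegral_enorm,
      ← ofReal_integral_norm_eq_lintegral_enorm (integrable_comp_chain hZ F e₀ k (h k))]
    refine ENNReal.ofReal_le_ofReal (le_trans (le_of_eq ?_) hk)
    exact integral_congr_ae (Eventually.of_forall fun ω => Real.norm_of_nonneg (hnonneg _ _))
  filter_upwards [hf.neg.exists_ae_tendsto_of_bdd hbdd] with ω ⟨l, hl⟩
  exact ⟨-l, by simpa using hl.neg⟩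

/-! ### Almost sure convergence of a Lyapunov function -/

include hZ in
/-- The almost supermartingale theorem of Robbins and Siegmund for a drift proportional to the
Lyapunov function itself, together with its consequence that the function tends to zero. -/
lemma ae_tendsto_zero_of_drift (hind : iIndepFun Z μ) {p : T → ℝ}
    (hp : ∀ k t, μ.real (Z k ⁻¹' {t}) = p t) (hp_sum : ∑ t, p t = 1)
    {α : ℕ → ℝ} (hα : IsStepsize α) {V : E → ℝ} (hV : ∀ e, 0 ≤ V e) {c C : ℝ} (hc : 0 < c)
    (hC : 0 ≤ C) (hdrift : ∀ k e, ∑ t, p t * V (F k e t) ≤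
      V e - c * α k * V e + C * α k ^ 2 * (1 + V e)) :
    ∀ᵐ ω ∂μ, Tendsto (fun k => V (chain F (fun j => Z j ω) e₀ k)) atTop (𝓝 0) := by
  -- `s k` compensates the growth factors `1 + C α²`; the sum of the drifts is carried along as a
  -- second component of the state.
  set s : ℕ → ℝ := fun k => ∑ j ∈ Finset.range k, C * α j ^ 2
  have hsucc : ∀ k, s (k + 1) = s k + C * α k ^ 2 := fun k => Finset.sum_range_succ _ _
  have hs : Tendsto s atTop (𝓝 (∑' j, C * α j ^ 2)) :=
    (hα.sq_summable.mul_left C).hasSum.tendsto_sum_nat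
  set L := ∑' j, C * α j ^ 2
  have hsL : ∀ k, s k ≤ L := fun k =>
    (hα.sq_summable.mul_left C).sum_le_tsum _ fun j _ => by positivity
  let F' : ℕ → E × ℝ → T → E × ℝ := fun k e t =>
    (F k e.1 t, e.2 + Real.exp (-s (k + 1)) * (c * α k * V e.1))
  let h : ℕ → E × ℝ → ℝ := fun k e => Real.exp (-s k) * (1 + V e.1) + max e.2 0
  have hnonneg : ∀ k e, 0 ≤ h k e := fun k e =>
    add_nonneg (mul_nonneg (Real.exp_pos _).le (by linarith [hV e.1])) (le_max_right _ _)
  have hle : ∀ k e, ∑ t, p t * h (k + 1) (F' k e t) ≤ h k e := by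
    intro k e
    have hterm0 : 0 ≤ Real.exp (-s (k + 1)) * (c * α k * V e.1) :=
      mul_nonneg (Real.exp_pos _).le (mul_nonneg (mul_pos hc (hα.pos k)).le (hV _))
    have hmax : max (e.2 + Real.exp (-s (k + 1)) * (c * α k * V e.1)) 0 ≤
        max e.2 0 + Real.exp (-s (k + 1)) * (c * α k * V e.1) :=
      max_le (by linarith [le_max_left e.2 0]) (by linarith [le_max_right e.2 0])
    have hsum : ∑ t, p t * h (k + 1) (F' k e t) =
        Real.exp (-s (k + 1)) * (1 + ∑ t, p t * V (F k e.1 t)) +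
          max (e.2 + Real.exp (-s (k + 1)) * (c * α k * V e.1)) 0 := by
      simp only [h, F', mul_add, Finset.sum_add_distrib, ← Finset.sum_mul, hp_sum, one_mul, mul_one,
        Finset.mul_sum]
      congr 2
      exact Finset.sum_congr rfl fun t _ => by ring
    have hexp : Real.exp (-s (k + 1)) * (1 + C * α k ^ 2) ≤ Real.exp (-s k) := by
      have h1 : 1 + C * α k ^ 2 ≤ Real.exp (C * α k ^ 2) := by
        linarith [Real.add_one_le_exp (C * α k ^ 2)]
      calc _ ≤ Real.exp (-s (k + 1)) * Real.exp (C * α k ^ 2) :=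
            mul_le_mul_of_nonneg_left h1 (Real.exp_pos _).le
        _ = Real.exp (-s k) := by rw [← Real.exp_add, hsucc]; congr 1; ring
    have hd := mul_le_mul_of_nonneg_left (hdrift k e.1) (Real.exp_pos (-s (k + 1))).le
    have he := mul_le_mul_of_nonneg_right hexp (by linarith [hV e.1] : 0 ≤ 1 + V e.1)
    rw [hsum]
    simp only [h]
    linarith
  have hchain : ∀ (z : ℕ → T) k, chain F' z (e₀, 0) k = (chain F z e₀ k,
      ∑ j ∈ Finset.range k, Real.exp (-s (j + 1)) * (c * α j * V (chain F z e₀ j))) := by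
    intro z k
    induction k with
    | zero => simp [chain]
    | succ k ih => simp [chain, ih, F', Finset.sum_range_succ]
  filter_upwards [ae_exists_tendsto_of_average_le hZ F' (e₀, 0) hind hp hnonneg hle] with ω ⟨l, hl⟩
  set W : ℕ → ℝ := fun k => V (chain F (fun j => Z j ω) e₀ k)
  have hW : ∀ k, 0 ≤ W k := fun k => hV _
  set q : ℕ → ℝ := fun j => Real.exp (-s (j + 1)) * (c * α j * W j)
  have hq : ∀ j, 0 ≤ q j := fun j =>
    mul_nonneg (Real.exp_pos _).le (mul_nonneg (mul_pos hc (hα.pos j)).le (hW j))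
  have hl' : Tendsto (fun k => Real.exp (-s k) * (1 + W k) + ∑ j ∈ Finset.range k, q j) atTop
      (𝓝 l) := by
    refine hl.congr fun k => ?_
    simp only [h, hchain]
    rw [max_eq_left (Finset.sum_nonneg fun j _ => hq j)]
  obtain ⟨B, hB⟩ := hl'.bddAbove_range
  have hqs : Summable q := by
    refine summable_of_sum_range_le (c := B) hq fun k => ?_
    have h1 := hB ⟨k, rfl⟩
    have h2 := mul_nonneg (Real.exp_pos (-s k)).le (by linarith [hW k] : 0 ≤ 1 + W k)
    simp only at h1
    linarith
  have hWlim : Tendsto W atTop (𝓝 (Real.exp L * (l - ∑' j, q j) - 1)) := by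
    have h1 := ((Real.continuous_exp.tendsto L).comp hs).mul (hl'.sub hqs.hasSum.tendsto_sum_nat)
    refine (h1.sub_const 1).congr fun k => ?_
    simp only [Function.comp, add_sub_cancel_right, ← mul_assoc, ← Real.exp_add]
    simp
  set m := Real.exp L * (l - ∑' j, q j) - 1
  have hm : 0 ≤ m := ge_of_tendsto' hWlim hW
  rcases hm.eq_or_lt with h0 | hpos
  · rwa [← h0] at hWlim
  exfalso
  -- A positive limit would bound `α` by a multiple of the summable sequence `q`.
  have hev : ∀ᶠ k in atTop, m / 2 < W k := hWlim.eventually_const_lt (by linarith)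
  set D := Real.exp (-L) * (c * (m / 2))
  have hD : 0 < D := by positivity
  have hsumm : Summable fun k => D * α k := by
    refine Summable.of_norm_bounded_eventually_nat hqs ?_
    filter_upwards [hev] with k hk
    have hαk := hα.pos k
    rw [Real.norm_of_nonneg (by positivity)]
    have h1 : Real.exp (-L) ≤ Real.exp (-s (k + 1)) := Real.exp_le_exp.2 (neg_le_neg (hsL _))
    calc D * α k = Real.exp (-L) * (c * α k * (m / 2)) := by simp only [D]; ring
      _ ≤ Real.exp (-s (k + 1)) * (c * α k * W k) := by gcongr
  have hαs : Summable α := (summable_mul_left_iff hD.ne').1 hsumm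
  exact not_tendsto_nhds_of_tendsto_atTop hα.sum_eq_top _ hαs.hasSum.tendsto_sum_nat

end Chain

/-! ### Homogeneous functions of degree two -/

section Homogeneous

variable {E : Type*} [NormedAddCommGroup E] [NormedSpace ℝ E]

lemma eq_norm_sq_mul_of_homogeneous {q : E → ℝ} (hq : ∀ (a : ℝ) v, q (a • v) = a ^ 2 * q v) {v : E}
    (hv : v ≠ 0) : q v = ‖v‖ ^ 2 * q (‖v‖⁻¹ • v) := by
  rw [← hq, smul_inv_smul₀ (norm_ne_zero_iff.2 hv)]

lemma inv_norm_smul_mem_sphere {v : E} (hv : v ≠ 0) : ‖v‖⁻¹ • v ∈ Metric.sphere (0 : E) 1 := by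
  simp [norm_smul, inv_mul_cancel₀ (norm_ne_zero_iff.2 hv)]

lemma bilin_smul_smul_self (B : LinearMap.BilinForm ℝ E) (a : ℝ) (v : E) :
    B (a • v) (a • v) = a ^ 2 * B v v := by
  simp only [map_smul, LinearMap.smul_apply, smul_eq_mul]
  ring

variable [FiniteDimensional ℝ E]

lemma exists_pos_mul_norm_sq_le {q : E → ℝ} (hc : Continuous q)
    (hq : ∀ (a : ℝ) v, q (a • v) = a ^ 2 * q v) (hpos : ∀ v, v ≠ 0 → 0 < q v) :
    ∃ m > 0, ∀ v, m * ‖v‖ ^ 2 ≤ q v := by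
  have : ProperSpace E := FiniteDimensional.proper ℝ E
  obtain ⟨m, hm, hle⟩ := (isCompact_sphere (0 : E) 1).exists_forall_le' hc.continuousOn (a := 0)
    fun v hv => hpos v (ne_zero_of_mem_unit_sphere ⟨v, hv⟩)
  refine ⟨m, hm, fun v => ?_⟩
  rcases eq_or_ne v 0 with rfl | hv
  · simpa using (hq 0 0).ge
  · rw [eq_norm_sq_mul_of_homogeneous hq hv, mul_comm]
    exact mul_le_mul_of_nonneg_left (hle _ (inv_norm_smul_mem_sphere hv)) (sq_nonneg _)

lemma exists_le_mul_norm_sq {q : E → ℝ} (hc : Continuous q)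
    (hq : ∀ (a : ℝ) v, q (a • v) = a ^ 2 * q v) : ∃ C > 0, ∀ v, q v ≤ C * ‖v‖ ^ 2 := by
  have : ProperSpace E := FiniteDimensional.proper ℝ E
  obtain ⟨C, hC⟩ := ((isCompact_sphere (0 : E) 1).image hc).bddAbove
  refine ⟨max C 1, lt_max_of_lt_right one_pos, fun v => ?_⟩
  rcases eq_or_ne v 0 with rfl | hv
  · simpa using (hq 0 0).le
  · rw [eq_norm_sq_mul_of_homogeneous hq hv, mul_comm]
    exact mul_le_mul_of_nonneg_right
      ((hC ⟨_, inv_norm_smul_mem_sphere hv, rfl⟩).trans (le_max_left _ _)) (sq_nonneg _)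

/-- The perturbation half of Finsler's lemma: if `q₀` is nonnegative and `q₁` is positive on the
nonzero zeros of `q₀`, then `q₀ + ε q₁` is positive definite for all small `ε > 0`. -/
lemma exists_pos_forall_add_mul_pos {q₀ q₁ : E → ℝ} (hc₀ : Continuous q₀) (hc₁ : Continuous q₁)
    (hq₀ : ∀ (a : ℝ) v, q₀ (a • v) = a ^ 2 * q₀ v) (hq₁ : ∀ (a : ℝ) v, q₁ (a • v) = a ^ 2 * q₁ v)
    (hnonneg : ∀ v, 0 ≤ q₀ v) (hpos : ∀ v, v ≠ 0 → q₀ v = 0 → 0 < q₁ v) :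
    ∃ ε₀ > 0, ∀ ε, 0 < ε → ε ≤ ε₀ → ∀ v, v ≠ 0 → 0 < q₀ v + ε * q₁ v := by
  have : ProperSpace E := FiniteDimensional.proper ℝ E
  -- Only the part of the sphere where `q₁ ≤ 0` matters; there `q₀` is bounded away from zero.
  have hK : IsCompact (Metric.sphere (0 : E) 1 ∩ {v | q₁ v ≤ 0}) :=
    (isCompact_sphere (0 : E) 1).inter_right (isClosed_le hc₁ continuous_const)
  obtain ⟨m, hm, hle⟩ := hK.exists_forall_le' hc₀.continuousOn (a := 0) fun v hv =>
    (hnonneg v).lt_of_ne' fun h0 =>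
      absurd (hpos v (ne_zero_of_mem_unit_sphere ⟨v, hv.1⟩) h0) (not_lt.2 hv.2)
  obtain ⟨C, hC, hC'⟩ := exists_le_mul_norm_sq hc₁.neg (q := fun v => -q₁ v) fun a v => by
    rw [hq₁]; ring
  refine ⟨m / (2 * C), by positivity, fun ε hε hε' v hv => ?_⟩
  have hu := inv_norm_smul_mem_sphere hv
  set u := ‖v‖⁻¹ • v
  rw [eq_norm_sq_mul_of_homogeneous hq₀ hv, eq_norm_sq_mul_of_homogeneous hq₁ hv]
  have hkey : 0 < q₀ u + ε * q₁ u := by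
    rcases lt_or_ge 0 (q₁ u) with h | h
    · have := hnonneg u
      positivity
    · have h1 := hle u ⟨hu, h⟩
      have h2 := hC' u
      rw [mem_sphere_zero_iff_norm.1 hu, one_pow, mul_one] at h2
      have h3 : ε * (2 * C) ≤ m := (le_div_iff₀ (by positivity)).1 hε'
      have h4 := mul_le_mul_of_nonneg_left h2 hε.le
      linarith
  have hn : 0 < ‖v‖ ^ 2 := by
    have := norm_pos_iff.2 hv
    positivity
  have := mul_pos hn hkey
  linarith

lemma continuous_bilin_self (B : LinearMap.BilinForm ℝ E) : Continuous fun v => B v v := by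
  have : (fun v => B v v) = fun v => B.toContinuousBilinearMap v v := rfl
  rw [this]
  fun_prop

end Homogeneous

/-! ### Linear stochastic approximation -/

section Linear

variable {E T : Type*} [NormedAddCommGroup E] [NormedSpace ℝ E]

/-- One step of linear stochastic approximation, `κ + αₖ (Gₜ κ + hₜ)` under the noise `t`. -/
def linearStep (α : ℕ → ℝ) (G : T → E →ₗ[ℝ] E) (h : T → E) (k : ℕ) (κ : E) (t : T) : E :=
  κ + α k • (G t κ + h t)

lemma chain_linearStep_add_sum_smul {ι : Type*} [Fintype ι] (α : ℕ → ℝ) (G : T → E →ₗ[ℝ] E)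
    (h : T → E) (z : ℕ → T) (c : ι → ℝ) (v : ι → E) (k : ℕ) :
    chain (linearStep α G h) z (∑ i, c i • v i) k = chain (linearStep α G h) z 0 k +
      ∑ i, c i • (chain (linearStep α G h) z (v i) k - chain (linearStep α G h) z 0 k) := by
  induction k with
  | zero => simp [chain]
  | succ k ih =>
    simp only [chain, linearStep]
    rw [ih]
    simp only [map_add, map_sum, map_smul, map_sub, smul_add, smul_sub, Finset.sum_add_distrib,
      Finset.sum_sub_distrib, Finset.smul_sum, smul_comm (α k)]
    abel

variable [FiniteDimensional ℝ E] [Fintype T]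

/-- A quadratic form that decreases strictly along the mean flow is a Lyapunov function of the
noisy iteration, up to an error of the order of the squared stepsize. -/
lemma exists_drift_of_lyapunov (α : ℕ → ℝ) (hα : ∀ k, 0 < α k) (G : T → E →ₗ[ℝ] E) (h : T → E)
    {p : T → ℝ} (hp : ∀ t, 0 ≤ p t) (hp_sum : ∑ t, p t = 1) (B : LinearMap.BilinForm ℝ E)
    (hsymm : ∀ v w, B v w = B w v) (hpos : ∀ v, v ≠ 0 → 0 < B v v)
    (hneg : ∀ v, v ≠ 0 → B v (∑ t, p t • G t v) < 0) {κ : E} (hκ : ∑ t, p t • (G t κ + h t) = 0) :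
    ∃ c > 0, ∃ C ≥ 0, ∀ k e, ∑ t, p t * B (linearStep α G h k e t - κ) (linearStep α G h k e t - κ) ≤
      B (e - κ) (e - κ) - c * α k * B (e - κ) (e - κ) +
        C * α k ^ 2 * (1 + B (e - κ) (e - κ)) := by
  let Gm : E →ₗ[ℝ] E := ∑ t, p t • G t
  have hGm : ∀ v, Gm v = ∑ t, p t • G t v := fun v => by simp [Gm, LinearMap.sum_apply]
  obtain ⟨m, hm, hm'⟩ := exists_pos_mul_norm_sq_le (continuous_bilin_self B)
    (bilin_smul_smul_self B) hpos
  obtain ⟨M, hM, hM'⟩ := exists_le_mul_norm_sq (continuous_bilin_self B) (bilin_smul_smul_self B)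
  obtain ⟨c, hc, hc'⟩ := exists_pos_mul_norm_sq_le
    (continuous_bilin_self (-(B.compl₂ Gm))) (bilin_smul_smul_self _) fun v hv => by
      simpa [hGm] using hneg v hv
  set g : T → E := fun t => G t κ + h t
  let L : ℝ := ∑ t, (‖(G t).toContinuousLinearMap‖ + ‖g t‖)
  have hL : ∀ t e, ‖G t e + g t‖ ≤ L * (1 + ‖e‖) := fun t e => by
    have h1 : ‖G t e‖ ≤ ‖(G t).toContinuousLinearMap‖ * ‖e‖ :=
      (G t).toContinuousLinearMap.le_opNorm e
    have h2 : ‖(G t).toContinuousLinearMap‖ + ‖g t‖ ≤ L :=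
      Finset.single_le_sum (f := fun t => ‖(G t).toContinuousLinearMap‖ + ‖g t‖)
        (fun t _ => by positivity) (Finset.mem_univ t)
    have h3 := norm_add_le (G t e) (g t)
    nlinarith [norm_nonneg e, norm_nonneg (g t), norm_nonneg (G t).toContinuousLinearMap]
  refine ⟨2 * c / M, by positivity, M * L ^ 2 * (2 + 2 / m), by positivity, fun k e' => ?_⟩
  set e := e' - κ
  set a := α k
  have hstep : ∀ t, linearStep α G h k e' t - κ = e + a • (G t e + g t) := fun t => by
    simp only [linearStep, g, e, map_sub, a]
    rw [show G t e' - G t κ + (G t κ + h t) = G t e' + h t by abel]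
    abel
  have hterm : ∀ t, B (e + a • (G t e + g t)) (e + a • (G t e + g t)) =
      B e e + 2 * a * B e (G t e + g t) + a ^ 2 * B (G t e + g t) (G t e + g t) := fun t => by
    generalize G t e + g t = w
    simp only [map_add, map_smul, LinearMap.add_apply, LinearMap.smul_apply, smul_eq_mul]
    rw [hsymm w e]
    ring
  have hmean : ∑ t, p t * B e (G t e + g t) = B e (Gm e) := by
    have h1 : ∑ t, p t * B e (G t e + g t) = B e (∑ t, p t • (G t e + g t)) := by
      simp only [map_sum, map_smul, smul_eq_mul]
    rw [h1]
    congr 1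
    simp only [smul_add, Finset.sum_add_distrib, hGm]
    simpa [g, smul_add, Finset.sum_add_distrib] using hκ
  have hce : B e (Gm e) ≤ -(c / M) * B e e := by
    have h1 : c * ‖e‖ ^ 2 ≤ -B e (Gm e) := by simpa using hc' e
    have h2 : c / M * B e e ≤ c * ‖e‖ ^ 2 := by
      calc c / M * B e e ≤ c / M * (M * ‖e‖ ^ 2) :=
            mul_le_mul_of_nonneg_left (hM' e) (by positivity)
        _ = c * ‖e‖ ^ 2 := by field_simp
    linarith
  have hsq : ∀ t, B (G t e + g t) (G t e + g t) ≤ M * L ^ 2 * (2 + 2 / m) * (1 + B e e) := by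
    intro t
    have h1 : ‖G t e + g t‖ ^ 2 ≤ L ^ 2 * (2 + 2 * ‖e‖ ^ 2) := by
      calc ‖G t e + g t‖ ^ 2 ≤ (L * (1 + ‖e‖)) ^ 2 := pow_le_pow_left₀ (norm_nonneg _) (hL t e) 2
        _ ≤ L ^ 2 * (2 + 2 * ‖e‖ ^ 2) := by
          rw [mul_pow]
          exact mul_le_mul_of_nonneg_left (by nlinarith [sq_nonneg (1 - ‖e‖)]) (sq_nonneg _)
    have h2 : ‖e‖ ^ 2 ≤ B e e / m := (le_div_iff₀ hm).2 (by linarith [hm' e])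
    have h3 : 0 ≤ B e e := le_trans (by positivity) (hm' e)
    have h4 : 2 + 2 * ‖e‖ ^ 2 ≤ (2 + 2 / m) * (1 + B e e) := by
      have h5 : (2 + 2 / m) * (1 + B e e) = 2 + 2 * B e e + 2 / m + 2 * (B e e / m) := by ring
      have h6 : 0 < 2 / m := by positivity
      linarith
    calc _ ≤ M * ‖G t e + g t‖ ^ 2 := hM' _
      _ ≤ M * (L ^ 2 * ((2 + 2 / m) * (1 + B e e))) := by gcongr; exact h1.trans (by gcongr)
      _ = _ := by ring
  have hsqsum : ∑ t, p t * B (G t e + g t) (G t e + g t) ≤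
      M * L ^ 2 * (2 + 2 / m) * (1 + B e e) := by
    calc _ ≤ ∑ t, p t * (M * L ^ 2 * (2 + 2 / m) * (1 + B e e)) :=
          Finset.sum_le_sum fun t _ => mul_le_mul_of_nonneg_left (hsq t) (hp t)
      _ = _ := by rw [← Finset.sum_mul, hp_sum, one_mul]
  have hexpand : ∑ t, p t * B (e + a • (G t e + g t)) (e + a • (G t e + g t)) =
      B e e + 2 * a * B e (Gm e) + a ^ 2 * ∑ t, p t * B (G t e + g t) (G t e + g t) := by
    rw [← hmean]
    simp only [hterm, mul_add, Finset.sum_add_distrib, ← Finset.sum_mul, hp_sum, one_mul,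
      Finset.mul_sum]
    congr 1
    · exact congrArg _ (Finset.sum_congr rfl fun t _ => by ring)
    · exact Finset.sum_congr rfl fun t _ => by ring
  simp only [hstep]
  rw [hexpand]
  have ha : 0 < a := hα k
  have h1 := mul_le_mul_of_nonneg_left hce (by positivity : 0 ≤ 2 * a)
  have h2 := mul_le_mul_of_nonneg_left hsqsum (sq_nonneg a)
  have h3 : 2 * a * (-(c / M) * B e e) = -(2 * c / M * a * B e e) := by ring
  linarith

variable {Ω : Type*} [MeasurableSpace Ω] {μ : Measure Ω} [IsProbabilityMeasure μ]
  [MeasurableSpace T] [MeasurableSingletonClass T]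

/-- Almost sure convergence of linear stochastic approximation with i.i.d. finite noise. The null
set does not depend on the initial state, because the iterates are affine functions of it; so the
initial state may be random, even in a non-measurable way or dependent on the noise. -/
theorem ae_forall_tendsto_linear {Z : ℕ → Ω → T} (hZ : ∀ k, Measurable (Z k))
    (hind : iIndepFun Z μ) {p : T → ℝ} (hlaw : ∀ k t, μ.real (Z k ⁻¹' {t}) = p t)
    (hp : ∀ t, 0 ≤ p t) (hp_sum : ∑ t, p t = 1) {α : ℕ → ℝ} (hα : IsStepsize α)
    (G : T → E →ₗ[ℝ] E) (h : T → E) (B : LinearMap.BilinForm ℝ E)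
    (hsymm : ∀ v w, B v w = B w v) (hpos : ∀ v, v ≠ 0 → 0 < B v v)
    (hneg : ∀ v, v ≠ 0 → B v (∑ t, p t • G t v) < 0) {κ : E} (hκ : ∑ t, p t • (G t κ + h t) = 0) :
    ∀ᵐ ω ∂μ, ∀ κ₀, Tendsto (chain (linearStep α G h) (fun j => Z j ω) κ₀) atTop (𝓝 κ) := by
  obtain ⟨c, hc, C, hC, hdrift⟩ :=
    exists_drift_of_lyapunov α hα.pos G h hp hp_sum B hsymm hpos hneg hκ
  obtain ⟨m, hm, hm'⟩ := exists_pos_mul_norm_sq_le (continuous_bilin_self B)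
    (bilin_smul_smul_self B) hpos
  have hfix : ∀ κ₀, ∀ᵐ ω ∂μ,
      Tendsto (chain (linearStep α G h) (fun j => Z j ω) κ₀) atTop (𝓝 κ) := by
    intro κ₀
    filter_upwards [ae_tendsto_zero_of_drift hZ (linearStep α G h) κ₀ hind hlaw hp_sum hα
      (V := fun e => B (e - κ) (e - κ)) (fun e => le_trans (by positivity) (hm' _)) hc hC hdrift]
      with ω hω
    rw [tendsto_iff_norm_sub_tendsto_zero]
    have hsq : Tendsto (fun k => ‖chain (linearStep α G h) (fun j => Z j ω) κ₀ k - κ‖ ^ 2) atTop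
        (𝓝 0) := by
      have hdiv := hω.div_const m
      rw [zero_div] at hdiv
      refine squeeze_zero (fun k => sq_nonneg _) (fun k => ?_) hdiv
      rw [le_div_iff₀ hm, mul_comm]
      exact hm' _
    simpa [Real.sqrt_sq (norm_nonneg _)] using hsq.sqrt
  let b := Module.finBasis ℝ E
  filter_upwards [hfix 0, ae_all_iff.2 fun i => hfix (b i)] with ω h0 hb κ₀
  have key := h0.add (tendsto_finsetSum Finset.univ fun i _ =>
    ((hb i).sub h0).const_smul (b.repr κ₀ i))
  simp only [sub_self, smul_zero, Finset.sum_const_zero, add_zero] at key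
  refine key.congr fun k => ?_
  rw [← chain_linearStep_add_sum_smul, b.sum_repr]

end Linear

/-! ### A Lyapunov function for the saddle-point flow -/

section Saddle

variable {n : Type*} [Fintype n]

/-- The linear vector field `(ν, u) ↦ (A u - C ν, -Aᵀ ν - N u)`. -/
def saddleField (A C N : Matrix n n ℝ) : (n → ℝ) × (n → ℝ) →ₗ[ℝ] (n → ℝ) × (n → ℝ) :=
  (A.mulVecLin ∘ₗ LinearMap.snd ℝ _ _ - C.mulVecLin ∘ₗ LinearMap.fst ℝ _ _).prod
    (-(Aᵀ.mulVecLin ∘ₗ LinearMap.fst ℝ _ _) - N.mulVecLin ∘ₗ LinearMap.snd ℝ _ _)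

@[simp]
lemma saddleField_apply (A C N : Matrix n n ℝ) (v : (n → ℝ) × (n → ℝ)) :
    saddleField A C N v = (A *ᵥ v.2 - C *ᵥ v.1, -(Aᵀ *ᵥ v.1) - N *ᵥ v.2) := rfl

/-- The bilinear form of `‖ν‖² + ‖u‖² - 2 ε ν ⬝ A u`. The squared norm alone does not decrease
strictly along `saddleField`; the cross term supplies the missing dissipation in `u`. -/
def crossForm (A : Matrix n n ℝ) (ε : ℝ) : LinearMap.BilinForm ℝ ((n → ℝ) × (n → ℝ)) :=
  LinearMap.mk₂ ℝ
    (fun v w => v.1 ⬝ᵥ w.1 + v.2 ⬝ᵥ w.2 - ε * (v.1 ⬝ᵥ (A *ᵥ w.2) + w.1 ⬝ᵥ (A *ᵥ v.2)))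
    (fun v v' w => by simp only [Prod.fst_add, Prod.snd_add, add_dotProduct, mulVec_add,
      dotProduct_add]; ring)
    (fun c v w => by simp only [Prod.smul_fst, Prod.smul_snd, smul_dotProduct, mulVec_smul,
      dotProduct_smul, smul_eq_mul]; ring)
    (fun v w w' => by simp only [Prod.fst_add, Prod.snd_add, add_dotProduct, mulVec_add,
      dotProduct_add]; ring)
    (fun c v w => by simp only [Prod.smul_fst, Prod.smul_snd, smul_dotProduct, mulVec_smul,
      dotProduct_smul, smul_eq_mul]; ring)

lemma crossForm_apply (A : Matrix n n ℝ) (ε : ℝ) (v w : (n → ℝ) × (n → ℝ)) :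
    crossForm A ε v w =
      v.1 ⬝ᵥ w.1 + v.2 ⬝ᵥ w.2 - ε * (v.1 ⬝ᵥ (A *ᵥ w.2) + w.1 ⬝ᵥ (A *ᵥ v.2)) := rfl

lemma crossForm_comm (A : Matrix n n ℝ) (ε : ℝ) (v w : (n → ℝ) × (n → ℝ)) :
    crossForm A ε v w = crossForm A ε w v := by
  rw [crossForm_apply, crossForm_apply, dotProduct_comm v.1 w.1, dotProduct_comm v.2 w.2]
  ring

lemma exists_pos_crossForm_pos (A : Matrix n n ℝ) :
    ∃ ε₀ > 0, ∀ ε, 0 < ε → ε ≤ ε₀ → ∀ v, v ≠ 0 → 0 < crossForm A ε v v := by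
  have hzero : ∀ v : (n → ℝ) × (n → ℝ), v.1 ⬝ᵥ v.1 + v.2 ⬝ᵥ v.2 = 0 → v = 0 := fun v hv => by
    have h1 : 0 ≤ v.1 ⬝ᵥ v.1 := dotProduct_self_star_nonneg v.1
    have h2 : 0 ≤ v.2 ⬝ᵥ v.2 := dotProduct_self_star_nonneg v.2
    exact Prod.ext (dotProduct_self_eq_zero.1 (by linarith))
      (dotProduct_self_eq_zero.1 (by linarith))
  obtain ⟨ε₀, h0, h⟩ := exists_pos_forall_add_mul_pos
    (q₀ := fun v : (n → ℝ) × (n → ℝ) => v.1 ⬝ᵥ v.1 + v.2 ⬝ᵥ v.2)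
    (q₁ := fun v => -(2 * (v.1 ⬝ᵥ (A *ᵥ v.2)))) (by fun_prop) (by fun_prop)
    (fun a v => by simp only [Prod.smul_fst, Prod.smul_snd, smul_dotProduct, dotProduct_smul,
      smul_eq_mul]; ring)
    (fun a v => by simp only [Prod.smul_fst, Prod.smul_snd, smul_dotProduct, dotProduct_smul,
      mulVec_smul, smul_eq_mul]; ring)
    (fun v => add_nonneg (dotProduct_self_star_nonneg v.1) (dotProduct_self_star_nonneg v.2))
    (fun v hv h => absurd (hzero v h) hv)
  refine ⟨ε₀, h0, fun ε hε hε' v hv => ?_⟩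
  have := h ε hε hε' v hv
  rw [crossForm_apply]
  linarith

lemma exists_pos_crossForm_saddleField_neg (A C N : Matrix n n ℝ)
    (hC : ∀ v, v ≠ 0 → 0 < v ⬝ᵥ (C *ᵥ v)) (hN : ∀ v, 0 ≤ v ⬝ᵥ (N *ᵥ v))
    (hAN : ∀ v, v ⬝ᵥ (N *ᵥ v) = 0 → A *ᵥ v = 0 → v = 0) :
    ∃ ε₀ > 0, ∀ ε, 0 < ε → ε ≤ ε₀ → ∀ v, v ≠ 0 → crossForm A ε v (saddleField A C N v) < 0 := by
  have hC' : ∀ v, 0 ≤ v ⬝ᵥ (C *ᵥ v) := fun v => by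
    rcases eq_or_ne v 0 with rfl | hv
    · simp
    · exact (hC v hv).le
  obtain ⟨ε₀, h0, h⟩ := exists_pos_forall_add_mul_pos
    (q₀ := fun v : (n → ℝ) × (n → ℝ) => v.1 ⬝ᵥ (C *ᵥ v.1) + v.2 ⬝ᵥ (N *ᵥ v.2))
    (q₁ := fun v => (A *ᵥ v.2) ⬝ᵥ (A *ᵥ v.2) - (C *ᵥ v.1) ⬝ᵥ (A *ᵥ v.2) -
      (Aᵀ *ᵥ v.1) ⬝ᵥ (Aᵀ *ᵥ v.1) - v.1 ⬝ᵥ (A *ᵥ (N *ᵥ v.2))) (by fun_prop) (by fun_prop)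
    (fun a v => by simp only [Prod.smul_fst, Prod.smul_snd, smul_dotProduct, dotProduct_smul,
      mulVec_smul, smul_eq_mul]; ring)
    (fun a v => by simp only [Prod.smul_fst, Prod.smul_snd, smul_dotProduct, dotProduct_smul,
      mulVec_smul, smul_eq_mul]; ring)
    (fun v => add_nonneg (hC' _) (hN _))
    (fun v hv hq => by
      have h1 : v.1 = 0 := by
        by_contra hne
        have := hC v.1 hne
        have := hN v.2
        linarith
      have h2 : v.2 ⬝ᵥ (N *ᵥ v.2) = 0 := by simpa [h1] using hq
      have h3 : A *ᵥ v.2 ≠ 0 := fun h3 => hv (Prod.ext h1 (hAN _ h2 h3))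
      have h4 : 0 < (A *ᵥ v.2) ⬝ᵥ (A *ᵥ v.2) := (dotProduct_self_star_nonneg (A *ᵥ v.2)).lt_of_ne'
        fun h4 => h3 (dotProduct_self_eq_zero.1 h4)
      simpa [h1] using h4)
  refine ⟨ε₀, h0, fun ε hε hε' v hv => ?_⟩
  have := h ε hε hε' v hv
  have e1 : v.2 ⬝ᵥ (Aᵀ *ᵥ v.1) = v.1 ⬝ᵥ (A *ᵥ v.2) := by
    rw [mulVec_transpose, ← dotProduct_comm, dotProduct_mulVec]
  have e2 : v.1 ⬝ᵥ (A *ᵥ (Aᵀ *ᵥ v.1)) = (Aᵀ *ᵥ v.1) ⬝ᵥ (Aᵀ *ᵥ v.1) := by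
    rw [dotProduct_mulVec, ← mulVec_transpose]
  rw [crossForm_apply, saddleField_apply]
  simp only [dotProduct_sub, sub_dotProduct, dotProduct_neg, mulVec_sub, mulVec_neg, e1, e2]
  linarith

end Saddle

/-! ### Moments of the sampling distribution -/

section Sampling

variable {S A : Type*} {K : ℕ} (x : S × A → Fin K → ℝ)

lemma Y_mulVec (u : Fin (K + 1) → ℝ) (i : S × A) : (Y x *ᵥ u) i = y x i ⬝ᵥ u := rfl

lemma Y_mulVec_injective [Nonempty (S × A)]
    (hx : ∀ w : Fin K → ℝ, w ≠ 0 → ∀ c : ℝ, X x *ᵥ w ≠ c • (1 : S × A → ℝ)) :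
    Function.Injective (Y x).mulVec := by
  refine (injective_iff_map_eq_zero (Y x).mulVecLin).2 fun u hu => ?_
  have hrow : ∀ i, u 0 + x i ⬝ᵥ Fin.tail u = 0 := fun i => by
    have h := congrFun hu i
    rw [mulVecLin_apply, Y_mulVec] at h
    simpa [y, dotProduct, Fin.sum_univ_succ, Fin.tail] using h
  have htail : Fin.tail u = 0 := by
    by_contra hne
    refine hx _ hne (-u 0) (funext fun i => ?_)
    have h : (X x *ᵥ Fin.tail u) i = x i ⬝ᵥ Fin.tail u := rfl
    rw [h, Pi.smul_apply, Pi.one_apply, smul_eq_mul]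
    linarith [hrow i]
  have h0 : u 0 = 0 := by simpa [htail] using hrow (Classical.arbitrary _)
  rw [← Fin.cons_self_tail u, h0, htail]
  ext j
  refine Fin.cases ?_ (fun i => ?_) j <;> simp

variable [Fintype S] (M : MDP S A)

lemma tdError_eq (z : (S × A) × (S × A)) (u : Fin (K + 1) → ℝ) :
    tdError M x z u = M.reward z.1.1 z.1.2 + (-e1 K + y x z.2 - y x z.1) ⬝ᵥ u := by
  simp only [tdError, add_dotProduct, sub_dotProduct, neg_dotProduct]
  ring

variable [Fintype A] (π : Policy S A) {d : S × A → ℝ}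

lemma sampleMass_nonneg (hd : ∀ i, 0 < d i) (z : (S × A) × (S × A)) : 0 ≤ sampleMass M π d z :=
  mul_nonneg (hd _).le (mul_nonneg (M.trans_nonneg _ _ _) (π.prob_nonneg _ _))

lemma sum_transition (i : S × A) : ∑ j : S × A, M.trans i.1 i.2 j.1 * π.prob j.1 j.2 = 1 := by
  rw [Fintype.sum_prod_type]
  simp only [← Finset.mul_sum, π.prob_sum, mul_one, M.trans_sum]

/-- The first marginal of the sampling distribution is `d`. -/
lemma expect_comp_fst {V : Type*} [AddCommGroup V] [Module ℝ V] (f : S × A → V) :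
    expect M π d (fun z => f z.1) = ∑ i, d i • f i := by
  rw [expect, Fintype.sum_prod_type]
  refine Finset.sum_congr rfl fun i _ => ?_
  simp only [sampleMass]
  rw [← Finset.sum_smul, ← Finset.mul_sum, sum_transition, mul_one]

lemma sum_sampleMass (hd_sum : ∑ i, d i = 1) : ∑ z, sampleMass M π d z = 1 := by
  have h := expect_comp_fst M π (d := d) (fun _ => (1 : ℝ))
  simpa [expect, hd_sum] using h

lemma expect_vecMulVec_mulVec {n : Type*} [Fintype n] (f g : (S × A) × (S × A) → n → ℝ)
    (u : n → ℝ) :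
    expect M π d (fun z => vecMulVec (f z) (g z)) *ᵥ u = expect M π d fun z => (g z ⬝ᵥ u) • f z := by
  simp only [expect, sum_mulVec, smul_mulVec, vecMulVec_mulVec, op_smul_eq_smul]

/-- The expected update direction of TD learning is `A u + b`. -/
lemma expect_tdError_smul (u : Fin (K + 1) → ℝ) :
    expect M π d (fun z => tdError M x z u • y x z.1) =
      Amat M π d x *ᵥ u + bvec M π d x := by
  rw [Amat, expect_vecMulVec_mulVec, bvec]
  simp only [expect, ← Finset.sum_add_distrib, ← smul_add, ← add_smul, tdError_eq]
  simp only [add_comm]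

lemma tdErrorVec_apply (u : Fin (K + 1) → ℝ) (i : S × A) :
    tdErrorVec M π x u i =
      ∑ j : S × A, (M.trans i.1 i.2 j.1 * π.prob j.1 j.2) * tdError M x (i, j) u := by
  have h : ∀ j : S × A, (M.trans i.1 i.2 j.1 * π.prob j.1 j.2) * tdError M x (i, j) u =
      (M.trans i.1 i.2 j.1 * π.prob j.1 j.2) * (M.reward i.1 i.2 - e1 K ⬝ᵥ u - y x i ⬝ᵥ u) +
        (M.trans i.1 i.2 j.1 * π.prob j.1 j.2) * (y x j ⬝ᵥ u) := fun j => by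
    simp only [tdError]
    ring
  simp only [h, Finset.sum_add_distrib, ← Finset.sum_mul, sum_transition, one_mul]
  simp only [tdErrorVec, rvec, Pmat, Pi.add_apply, Pi.sub_apply, Pi.smul_apply, Pi.one_apply,
    smul_eq_mul, mul_one, Y_mulVec]
  have h2 : ((Matrix.of fun i j : S × A => M.trans i.1 i.2 j.1 * π.prob j.1 j.2) *ᵥ (Y x *ᵥ u)) i =
      ∑ j : S × A, (M.trans i.1 i.2 j.1 * π.prob j.1 j.2) * (y x j ⬝ᵥ u) := rfl
  rw [h2]
  ring

end Sampling

/-! ### Identifiability and TD fixed points -/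

section Identified

variable {S A : Type*} {K : ℕ} [Fintype S] [Fintype A] {M : MDP S A} {π : Policy S A}
  {d : S × A → ℝ} {x : S × A → Fin K → ℝ}

lemma dotProduct_I0_mulVec (u : Fin (K + 1) → ℝ) :
    u ⬝ᵥ (I0 K *ᵥ u) = ∑ i : Fin K, u i.succ ^ 2 := by
  simp only [I0, dotProduct, mulVec_diagonal, Fin.sum_univ_succ]
  simp [e1, sq]

/-- The condition under which the objective is strictly convex: no direction is invisible both to
the penalty and to `A`. -/
def IsIdentified (M : MDP S A) (π : Policy S A) (d : S × A → ℝ) (x : S × A → Fin K → ℝ)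
    (η : ℝ) : Prop :=
  ∀ u, η * (u ⬝ᵥ (I0 K *ᵥ u)) = 0 → Amat M π d x *ᵥ u = 0 → u = 0

/-- With a positive penalty the only unpenalized direction is `e₁`, and the first component of
`A e₁ = -𝔼[y]` is `-1`. -/
lemma isIdentified_of_pos (hd_sum : ∑ i, d i = 1) {η : ℝ} (hη : 0 < η) :
    IsIdentified M π d x η := by
  intro u hu hAu
  have hsucc : ∀ i : Fin K, u i.succ = 0 := by
    rw [dotProduct_I0_mulVec, mul_eq_zero_iff_left hη.ne',
      Finset.sum_eq_zero_iff_of_nonneg fun i _ => sq_nonneg _] at hu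
    exact fun i => pow_eq_zero_iff two_ne_zero |>.1 (hu i (Finset.mem_univ i))
  have hy : ∀ i : S × A, y x i ⬝ᵥ u = u 0 := fun i => by
    simp [y, dotProduct, Fin.sum_univ_succ, hsucc]
  have hAu0 := congrFun hAu 0
  rw [Amat, expect_vecMulVec_mulVec] at hAu0
  have hterm : ∀ z : (S × A) × (S × A), (-e1 K + y x z.2 - y x z.1) ⬝ᵥ u = -u 0 := fun z => by
    rw [sub_dotProduct, add_dotProduct, neg_dotProduct, hy, hy]
    simp [e1]
  have hu0 : u 0 = 0 := by
    simp only [hterm] at hAu0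
    simpa [expect, Finset.sum_apply, y, ← Finset.sum_mul, sum_sampleMass M π hd_sum] using hAu0
  ext j
  exact Fin.cases hu0 hsucc j

lemma isIdentified_of_isUnit (hA : IsUnit (Amat M π d x)) (η : ℝ) : IsIdentified M π d x η :=
  fun u _ hAu => mulVec_injective_iff_isUnit.2 hA (by rw [hAu, mulVec_zero])

lemma isTDFixedPoint_iff (hA : IsUnit (Amat M π d x)) (u : Fin (K + 1) → ℝ) :
    IsTDFixedPoint M π d x u ↔ u = uTD M π d x := by
  have hAdet := (isUnit_iff_isUnit_det _).1 hA
  have hTD : Amat M π d x *ᵥ uTD M π d x = -bvec M π d x := by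
    rw [uTD, mulVec_neg, mulVec_mulVec, mul_nonsing_inv _ hAdet, one_mulVec]
  rw [IsTDFixedPoint, expect_tdError_smul, add_eq_zero_iff_eq_neg, ← hTD]
  exact (mulVec_injective_iff_isUnit.2 hA).eq_iff

end Identified

/-! ### The objective -/

section Objective

variable {S A : Type*} {K : ℕ} [Fintype S] [Fintype A] (M : MDP S A) (π : Policy S A)
  {d : S × A → ℝ} (x : S × A → Fin K → ℝ) [DecidableEq S] [DecidableEq A]

lemma Y_transpose_mul_diagonal_mulVec (f : S × A → ℝ) :
    ((Y x)ᵀ * Matrix.diagonal d) *ᵥ f = ∑ i, d i • f i • y x i := by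
  ext j
  rw [← mulVec_mulVec, mulVec, dotProduct, Finset.sum_apply]
  simp only [transpose_apply, Y, of_apply, mulVec_diagonal, Pi.smul_apply, smul_eq_mul]
  exact Finset.sum_congr rfl fun i _ => by ring

lemma Cmat_eq_expect : Cmat d x = expect M π d fun z => vecMulVec (y x z.1) (y x z.1) := by
  rw [expect_comp_fst M π fun i => vecMulVec (y x i) (y x i)]
  ext j k
  rw [Cmat, mul_apply, Matrix.sum_apply]
  simp only [mul_diagonal, transpose_apply, Y, of_apply, Matrix.smul_apply, vecMulVec_apply, smul_eq_mul]
  exact Finset.sum_congr rfl fun i _ => by ring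

lemma Y_transpose_mul_diagonal_mulVec_tdErrorVec (u : Fin (K + 1) → ℝ) :
    ((Y x)ᵀ * Matrix.diagonal d) *ᵥ tdErrorVec M π x u =
      Amat M π d x *ᵥ u + bvec M π d x := by
  rw [Y_transpose_mul_diagonal_mulVec, ← expect_tdError_smul]
  refine Eq.trans ?_ (Fintype.sum_prod_type _).symm
  refine Finset.sum_congr rfl fun i _ => ?_
  simp only [tdErrorVec_apply, sampleMass, Finset.sum_smul, Finset.smul_sum, smul_smul, mul_assoc]

lemma Cmat_posDef (hd : ∀ i, 0 < d i) (hY : Function.Injective (Y x).mulVec) :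
    (Cmat d x).PosDef := by
  have h := (PosDef.diagonal hd).conjTranspose_mul_mul_same hY
  rwa [conjTranspose_eq_transpose_of_trivial] at h

variable {x}

lemma Cmat_transpose (hC : (Cmat d x).PosDef) : (Cmat d x)ᵀ = Cmat d x :=
  (conjTranspose_eq_transpose_of_trivial _).symm.trans hC.isHermitian

lemma isUnit_det_Cmat (hC : (Cmat d x).PosDef) : IsUnit (Cmat d x).det :=
  (isUnit_iff_isUnit_det _).1 hC.isUnit

lemma sqNorm_projY_mulVec (hC : (Cmat d x).PosDef) (f : S × A → ℝ) :
    sqNorm (Matrix.diagonal d) (projY d x *ᵥ f) =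
      sqNorm (Cmat d x)⁻¹ (((Y x)ᵀ * Matrix.diagonal d) *ᵥ f) := by
  set g := ((Y x)ᵀ * Matrix.diagonal d) *ᵥ f
  have hproj : projY d x *ᵥ f = Y x *ᵥ ((Cmat d x)⁻¹ *ᵥ g) := by
    simp only [projY, Cmat, g, mulVec_mulVec, Matrix.mul_assoc]
  have hCY : (Y x)ᵀ *ᵥ (Matrix.diagonal d *ᵥ (Y x *ᵥ ((Cmat d x)⁻¹ *ᵥ g))) = g := by
    have h : (Y x)ᵀ *ᵥ (Matrix.diagonal d *ᵥ (Y x *ᵥ ((Cmat d x)⁻¹ *ᵥ g))) =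
        Cmat d x *ᵥ ((Cmat d x)⁻¹ *ᵥ g) := by
      simp only [Cmat, mulVec_mulVec, Matrix.mul_assoc]
    rw [h, mulVec_mulVec, mul_nonsing_inv _ (isUnit_det_Cmat hC), one_mulVec]
  rw [sqNorm, sqNorm, hproj, dotProduct_comm, dotProduct_mulVec, ← mulVec_transpose, hCY]

variable {π M}

lemma J1_eq_mspbe1_add (hC : (Cmat d x).PosDef) (η : ℝ) (u : Fin (K + 1) → ℝ) :
    J1 M π d x η u = mspbe1 M π d x u + η * ∑ i : Fin K, u i.succ ^ 2 := by
  rw [J1, mspbe1, sqNorm_projY_mulVec hC, Y_transpose_mul_diagonal_mulVec_tdErrorVec,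
    dotProduct_I0_mulVec]

lemma dotProduct_Hmat_mulVec (η : ℝ) (u v : Fin (K + 1) → ℝ) :
    u ⬝ᵥ (Hmat M π d x η *ᵥ v) = η * (u ⬝ᵥ (I0 K *ᵥ v)) +
      (Amat M π d x *ᵥ u) ⬝ᵥ ((Cmat d x)⁻¹ *ᵥ (Amat M π d x *ᵥ v)) := by
  rw [Hmat, add_mulVec, dotProduct_add, smul_mulVec, dotProduct_smul, smul_eq_mul,
    Matrix.mul_assoc, ← mulVec_mulVec, dotProduct_mulVec u (Amat M π d x)ᵀ, vecMul_transpose,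
    mulVec_mulVec]

variable {η : ℝ}

lemma dotProduct_Hmat_mulVec_pos (hC : (Cmat d x).PosDef) (hη : 0 ≤ η)
    (hid : IsIdentified M π d x η) {u : Fin (K + 1) → ℝ} (hu : u ≠ 0) :
    0 < u ⬝ᵥ (Hmat M π d x η *ᵥ u) := by
  rw [dotProduct_Hmat_mulVec]
  have h1 : 0 ≤ η * (u ⬝ᵥ (I0 K *ᵥ u)) := by
    rw [dotProduct_I0_mulVec]
    positivity
  rcases eq_or_ne (Amat M π d x *ᵥ u) 0 with hA | hA
  · rw [hA, zero_dotProduct, add_zero]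
    exact h1.lt_of_ne' fun h => hu (hid u h hA)
  · have h2 := hC.inv.dotProduct_mulVec_pos hA
    rw [star_trivial] at h2
    linarith

lemma isUnit_Hmat (hC : (Cmat d x).PosDef) (hη : 0 ≤ η) (hid : IsIdentified M π d x η) :
    IsUnit (Hmat M π d x η) := by
  refine mulVec_injective_iff_isUnit.1
    ((injective_iff_map_eq_zero (Hmat M π d x η).mulVecLin).2 fun u hu => ?_)
  by_contra hne
  have := dotProduct_Hmat_mulVec_pos hC hη hid hne
  rw [mulVecLin_apply] at hu
  simp [hu] at this

/-- The first-order condition of the objective at `u*`. -/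
lemma Hmat_mulVec_uStar (hH : IsUnit (Hmat M π d x η)) :
    Hmat M π d x η *ᵥ uStar M π d x η =
      -((Amat M π d x)ᵀ *ᵥ ((Cmat d x)⁻¹ *ᵥ bvec M π d x)) := by
  rw [uStar, mulVec_neg, mulVec_mulVec, Matrix.mul_assoc, mul_nonsing_inv_cancel_left _ _
    ((isUnit_iff_isUnit_det _).1 hH), mulVec_mulVec]

/-- Completing the square. -/
lemma J1_eq_J1_uStar_add (hC : (Cmat d x).PosDef) (hH : IsUnit (Hmat M π d x η))
    (u : Fin (K + 1) → ℝ) :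
    J1 M π d x η u = J1 M π d x η (uStar M π d x η) +
      (u - uStar M π d x η) ⬝ᵥ (Hmat M π d x η *ᵥ (u - uStar M π d x η)) := by
  have hsymm : ∀ v w, v ⬝ᵥ ((Cmat d x)⁻¹ *ᵥ w) = w ⬝ᵥ ((Cmat d x)⁻¹ *ᵥ v) := fun v w => by
    rw [dotProduct_mulVec, ← mulVec_transpose, transpose_nonsing_inv, Cmat_transpose hC,
      dotProduct_comm]
  have hI : ∀ v w, v ⬝ᵥ (I0 K *ᵥ w) = w ⬝ᵥ (I0 K *ᵥ v) := fun v w => by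
    rw [dotProduct_mulVec, ← mulVec_transpose, I0, diagonal_transpose, dotProduct_comm]
  have hfoc := congrArg (fun w => (u - uStar M π d x η) ⬝ᵥ w) (Hmat_mulVec_uStar hH)
  simp only [dotProduct_neg] at hfoc
  rw [dotProduct_mulVec _ (Amat M π d x)ᵀ, vecMul_transpose, dotProduct_Hmat_mulVec] at hfoc
  rw [dotProduct_Hmat_mulVec, J1, J1, sqNorm, sqNorm]
  generalize uStar M π d x η = s at *
  simp only [mulVec_add, mulVec_sub, dotProduct_add, add_dotProduct, dotProduct_sub,
    sub_dotProduct] at hfoc ⊢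
  have h1 := hsymm (Amat M π d x *ᵥ s) (Amat M π d x *ᵥ u)
  have h2 := hsymm (bvec M π d x) (Amat M π d x *ᵥ u)
  have h3 := hsymm (bvec M π d x) (Amat M π d x *ᵥ s)
  have h4 := hI s u
  rw [h1, h2, h3, h4]
  linear_combination 2 * hfoc

lemma J1_uStar_lt (hC : (Cmat d x).PosDef) (hη : 0 ≤ η) (hid : IsIdentified M π d x η)
    {u : Fin (K + 1) → ℝ} (hu : u ≠ uStar M π d x η) :
    J1 M π d x η (uStar M π d x η) < J1 M π d x η u := by
  rw [J1_eq_J1_uStar_add hC (isUnit_Hmat hC hη hid) u]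
  linarith [dotProduct_Hmat_mulVec_pos hC hη hid (sub_ne_zero.2 hu)]

lemma uStar_zero (hC : (Cmat d x).PosDef) (hA : IsUnit (Amat M π d x)) :
    uStar M π d x 0 = uTD M π d x := by
  have hAdet := (isUnit_iff_isUnit_det _).1 hA
  have hAT : IsUnit ((Amat M π d x)ᵀ).det := by rwa [det_transpose]
  rw [uStar, uTD, Hmat, zero_smul, zero_add, Matrix.mul_inv_rev, Matrix.mul_inv_rev,
    nonsing_inv_nonsing_inv _ (isUnit_det_Cmat hC), ← Matrix.mul_assoc (Amat M π d x)⁻¹,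
    Matrix.mul_assoc _ _ (Amat M π d x)ᵀ, nonsing_inv_mul _ hAT, Matrix.mul_one, Matrix.mul_assoc,
    mul_nonsing_inv _ (isUnit_det_Cmat hC), Matrix.mul_one]

end Objective

/-! ### Convergence of Diff-GQ1 -/

section Convergence

variable {S A : Type*} {K : ℕ} [Fintype S] [Fintype A]

/-- The random linear part of the joint update of `(ν, u)`. -/
def updateMap (x : S × A → Fin K → ℝ) (η : ℝ) (z : (S × A) × (S × A)) :
    (Fin (K + 1) → ℝ) × (Fin (K + 1) → ℝ) →ₗ[ℝ] (Fin (K + 1) → ℝ) × (Fin (K + 1) → ℝ) :=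
  saddleField (vecMulVec (y x z.1) (-e1 K + y x z.2 - y x z.1)) (vecMulVec (y x z.1) (y x z.1))
    (η • I0 K)

/-- The random constant part of the joint update of `(ν, u)`. -/
def updateConst (M : MDP S A) (x : S × A → Fin K → ℝ) (z : (S × A) × (S × A)) :
    (Fin (K + 1) → ℝ) × (Fin (K + 1) → ℝ) :=
  (M.reward z.1.1 z.1.2 • y x z.1, 0)

lemma diffGQ1_eq_chain (M : MDP S A) (x : S × A → Fin K → ℝ) (η : ℝ) (α : ℕ → ℝ)
    (z : ℕ → (S × A) × (S × A)) (κ₀ : (Fin (K + 1) → ℝ) × (Fin (K + 1) → ℝ)) (k : ℕ) :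
    diffGQ1 M x η α z κ₀ k =
      chain (linearStep α (updateMap x η) (updateConst M x)) z κ₀ k := by
  induction k with
  | zero => rfl
  | succ k ih =>
    rw [chain, ← ih, diffGQ1, linearStep, updateMap, updateConst, saddleField_apply]
    refine Prod.ext ?_ ?_
    · simp only [Prod.fst_add, Prod.smul_fst, vecMulVec_mulVec, op_smul_eq_smul, tdError_eq,
        ← sub_smul, ← add_smul, smul_smul]
      congr 3
      ring
    · simp only [Prod.snd_add, Prod.smul_snd, transpose_vecMulVec, vecMulVec_mulVec,
        op_smul_eq_smul, smul_mulVec, smul_zero, smul_neg, smul_smul, sub_eq_add_neg, smul_add,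
        neg_add, neg_neg]
      abel

variable {M : MDP S A} {π : Policy S A} {d : S × A → ℝ} {x : S × A → Fin K → ℝ} {η : ℝ}
  [DecidableEq S] [DecidableEq A]

lemma expect_updateMap (hd_sum : ∑ i, d i = 1) (v : (Fin (K + 1) → ℝ) × (Fin (K + 1) → ℝ)) :
    ∑ z, sampleMass M π d z • updateMap x η z v =
      saddleField (Amat M π d x) (Cmat d x) (η • I0 K) v := by
  have hN : ∑ z, sampleMass M π d z • η • I0 K *ᵥ v.2 = η • I0 K *ᵥ v.2 := by
    rw [← Finset.sum_smul, sum_sampleMass M π hd_sum, one_smul]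
  rw [saddleField_apply, Cmat_eq_expect M π]
  simp only [updateMap, saddleField_apply, Amat, expect]
  refine Prod.ext ?_ ?_
  · simp only [Prod.fst_sum, Prod.smul_fst, smul_sub, Finset.sum_sub_distrib, sum_mulVec,
      smul_mulVec]
  · rw [Prod.snd_sum]
    simp only [Prod.smul_snd, smul_sub, Finset.sum_sub_distrib, hN, transpose_sum,
      transpose_smul, sum_mulVec, smul_mulVec, smul_neg, Finset.sum_neg_distrib]

/-- The stationary point of the mean dynamics: `ν = C⁻¹ (A u* + b)` and `u = u*`. -/
lemma expect_update_eq_zero (hd_sum : ∑ i, d i = 1) (hC : (Cmat d x).PosDef)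
    (hH : IsUnit (Hmat M π d x η)) :
    ∑ z, sampleMass M π d z • (updateMap x η z
      ((Cmat d x)⁻¹ *ᵥ (Amat M π d x *ᵥ uStar M π d x η + bvec M π d x), uStar M π d x η) +
        updateConst M x z) = 0 := by
  have hb : ∑ z, sampleMass M π d z • updateConst M x z = (bvec M π d x, 0) := by
    refine Prod.ext ?_ ?_
    · rw [Prod.fst_sum]
      rfl
    · rw [Prod.snd_sum]
      simp [updateConst]
  have hfoc := Hmat_mulVec_uStar hH
  rw [Hmat, add_mulVec, Matrix.mul_assoc, ← mulVec_mulVec, ← mulVec_mulVec] at hfoc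
  simp only [smul_add, Finset.sum_add_distrib]
  rw [expect_updateMap hd_sum, hb, saddleField_apply]
  refine Prod.ext ?_ ?_
  · simp only [Prod.fst_add, Prod.fst_zero]
    rw [mulVec_mulVec, mul_nonsing_inv _ (isUnit_det_Cmat hC), one_mulVec]
    abel
  · simp only [Prod.snd_add, Prod.snd_zero, add_zero, mulVec_add]
    rw [eq_neg_iff_add_eq_zero] at hfoc
    rw [← neg_eq_zero, ← hfoc]
    abel

variable [MeasurableSpace S] [MeasurableSingletonClass S] [MeasurableSpace A]
  [MeasurableSingletonClass A] {Ω : Type*} [MeasurableSpace Ω] {μ : Measure Ω}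
  [IsProbabilityMeasure μ] {Z : ℕ → Ω → (S × A) × (S × A)} {α : ℕ → ℝ}

lemma ae_forall_tendsto_diffGQ1 (hd_pos : ∀ i, 0 < d i) (hd_sum : ∑ i, d i = 1)
    (hZ : IsIIDSample M π d μ Z) (hα : IsStepsize α) (hC : (Cmat d x).PosDef) (hη : 0 ≤ η)
    (hid : IsIdentified M π d x η) :
    ∀ᵐ ω ∂μ, ∀ κ₀, Tendsto (fun k => (diffGQ1 M x η α (fun j => Z j ω) κ₀ k).2) atTop
      (𝓝 (uStar M π d x η)) := by
  have hC' : ∀ v, v ≠ 0 → 0 < v ⬝ᵥ (Cmat d x *ᵥ v) := fun v hv => by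
    simpa using hC.dotProduct_mulVec_pos hv
  have hN : ∀ v, v ⬝ᵥ ((η • I0 K) *ᵥ v) = η * (v ⬝ᵥ (I0 K *ᵥ v)) := fun v => by
    rw [smul_mulVec, dotProduct_smul, smul_eq_mul]
  obtain ⟨ε₁, h1, hpos⟩ := exists_pos_crossForm_pos (Amat M π d x)
  obtain ⟨ε₂, h2, hneg⟩ := exists_pos_crossForm_saddleField_neg (Amat M π d x) (Cmat d x)
    (η • I0 K) hC' (fun v => by rw [hN, dotProduct_I0_mulVec]; positivity)
    (fun v hv => hid v ((hN v).symm.trans hv))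
  set ε := min ε₁ ε₂
  have hε : 0 < ε := lt_min h1 h2
  filter_upwards [ae_forall_tendsto_linear hZ.measurable hZ.indep (p := sampleMass M π d)
    (fun k z => by
      rw [measureReal_def, hZ.law, ENNReal.toReal_ofReal (sampleMass_nonneg M π hd_pos z)])
    (sampleMass_nonneg M π hd_pos) (sum_sampleMass M π hd_sum) hα (updateMap x η)
    (updateConst M x) (crossForm (Amat M π d x) ε) (crossForm_comm _ _)
    (hpos ε hε (min_le_left _ _))
    (fun v hv => by rw [expect_updateMap hd_sum]; exact hneg ε hε (min_le_right _ _) v hv)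
    (expect_update_eq_zero hd_sum hC (isUnit_Hmat hC hη hid))] with ω hω κ₀
  simp only [diffGQ1_eq_chain]
  exact (continuous_snd.tendsto _).comp (hω κ₀)

end Convergence

end DiffGQ

theorem theorem1 {S A : Type*} [Fintype S] [Fintype A] [DecidableEq S] [DecidableEq A]
    [MeasurableSpace S] [MeasurableSingletonClass S]
    [MeasurableSpace A] [MeasurableSingletonClass A]
    {Ω : Type*} [MeasurableSpace Ω] (μ : Measure Ω) [IsProbabilityMeasure μ]
    {K : ℕ} (M : DiffGQ.MDP S A) (π : DiffGQ.Policy S A)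
    (hchain : DiffGQ.IsUnichain (DiffGQ.stateMatrix M π))
    (d : S × A → ℝ) (hd_pos : ∀ i, 0 < d i) (hd_sum : ∑ i, d i = 1)
    (Z : ℕ → Ω → (S × A) × (S × A)) (hZ : DiffGQ.IsIIDSample M π d μ Z)
    (x : S × A → Fin K → ℝ)
    (hx : ∀ w : Fin K → ℝ, w ≠ 0 → ∀ c : ℝ, DiffGQ.X x *ᵥ w ≠ c • (1 : S × A → ℝ))
    (α : ℕ → ℝ) (hα : DiffGQ.IsStepsize α)
    (κ₀ : Ω → (Fin (K + 1) → ℝ) × (Fin (K + 1) → ℝ)) :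
    IsUnit (DiffGQ.Cmat d x) ∧
    (∀ η u, DiffGQ.J1 M π d x η u = DiffGQ.mspbe1 M π d x u + η * ∑ i : Fin K, u i.succ ^ 2) ∧
    (∀ η : ℝ, 0 < η →
      IsUnit (DiffGQ.Hmat M π d x η) ∧
      (∀ᵐ ω ∂μ, Tendsto (fun k => (DiffGQ.diffGQ1 M x η α (fun j => Z j ω) (κ₀ ω) k).2) atTop
        (𝓝 (DiffGQ.uStar M π d x η))) ∧
      ∀ u, u ≠ DiffGQ.uStar M π d x η →
        DiffGQ.J1 M π d x η (DiffGQ.uStar M π d x η) < DiffGQ.J1 M π d x η u) ∧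
    (IsUnit (DiffGQ.Amat M π d x) →
      IsUnit (DiffGQ.Hmat M π d x 0) ∧
      DiffGQ.uStar M π d x 0 = DiffGQ.uTD M π d x ∧
      (∀ u, DiffGQ.IsTDFixedPoint M π d x u ↔ u = DiffGQ.uTD M π d x) ∧
      (∀ᵐ ω ∂μ, Tendsto (fun k => (DiffGQ.diffGQ1 M x 0 α (fun j => Z j ω) (κ₀ ω) k).2) atTop
        (𝓝 (DiffGQ.uTD M π d x))) ∧
      ∀ u, u ≠ DiffGQ.uTD M π d x →
        DiffGQ.J1 M π d x 0 (DiffGQ.uTD M π d x) < DiffGQ.J1 M π d x 0 u) := by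
  have hne : Nonempty (S × A) := by
    by_contra h
    rw [not_nonempty_iff] at h
    simp at hd_sum
  have hC := DiffGQ.Cmat_posDef x hd_pos (DiffGQ.Y_mulVec_injective x hx)
  refine ⟨hC.isUnit, DiffGQ.J1_eq_mspbe1_add hC, fun η hη => ?_, fun hA => ?_⟩
  · have hid := DiffGQ.isIdentified_of_pos (M := M) (π := π) (x := x) hd_sum hη
    refine ⟨DiffGQ.isUnit_Hmat hC hη.le hid, ?_, fun u hu => DiffGQ.J1_uStar_lt hC hη.le hid hu⟩
    filter_upwards [DiffGQ.ae_forall_tendsto_diffGQ1 hd_pos hd_sum hZ hα hC hη.le hid] with ω hω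
    exact hω (κ₀ ω)
  · have hid := DiffGQ.isIdentified_of_isUnit hA 0
    have hTD := DiffGQ.uStar_zero hC hA
    refine ⟨DiffGQ.isUnit_Hmat hC le_rfl hid, hTD, DiffGQ.isTDFixedPoint_iff hA, ?_, ?_⟩
    · rw [← hTD]
      filter_upwards [DiffGQ.ae_forall_tendsto_diffGQ1 hd_pos hd_sum hZ hα hC le_rfl hid] with ω hω
      exact hω (κ₀ ω)
    · rw [← hTD]
      exact fun u hu => DiffGQ.J1_uStar_lt hC le_rfl hid hu
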